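/- Let $G$ be an abelian group and let $\phi$ be an endomorphism of $G$. A *string* of $\phi$ is a sequence $(x_n)_{n\in\mathbb N}$ of pairwise distinct elements of $G$ such that $\phi(x_n)=x_{n-1}$ for every $n\ge 1$. A *null string* of $\phi$ is a string of $\phi$ such that $x_0\neq 0$ and $\phi^k(x_0)=0$ for some $k\ge 1$. Two strings are disjoint if their sets of elements are disjoint. Let $s(\phi)$ (respectively $s_0(\phi)$) be the supremum of the cardinalities of the families of pairwise disjoint strings (respectively null strings) of $\phi$, taken in $\mathbb N\cup\{\infty\}$, where every infinite cardinal counts as $\infty$. Put $$s(G)=\sup\{s(\phi):\phi\in\mathrm{End}(G)\},\qquad s_0(G)=\sup\{s_0(\phi):\phi\in\mathrm{End}(G)\}.$$ **Theorem.** (1) Let $p$ be a prime and let $G$ be a reduced abelian $p$-group (that is, every element of $G$ has order a power of $p$, and $0$ is the only divisible subgroup of $G$). Then the following conditions are equivalent: (a) $s(G)=0$; (b) $s_0(G)=0$; (c) $G$ is finite. In particular, $s(G)=s_0(G)$. (2) Denote by $\mathfrak S$ and $\mathfrak S_0$ the classes of all abelian groups $G$ with $s(G)=0$, respectively $s_0(G)=0$.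 Let $G$ be a torsion abelian group. Then the following conditions are equivalent: (a) $s(G)=0$, i.e. $G\in\mathfrak S$; (b) $s_0(G)=0$, i.e. $G\in\mathfrak S_0$; (c) for every prime $p$ the $p$-component $t_p(G)$, consisting of the elements of $G$ whose order is a power of $p$, is finite. -/

import Mathlib

namespace StringNumber

universe u

variable {G : Type u} [AddCommGroup G]

/-- A sequence `x₀, x₁, …` with `φ(xₙ) = xₙ₋₁` for every `n ≥ 1`. -/
def IsPseudostring (φ : AddMonoid.End G) (x : ℕ → G) : Prop :=
  ∀ n : ℕ, φ (x (n + 1)) = x n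

/-- A pseudostring with pairwise distinct elements. -/
def IsString (φ : AddMonoid.End G) (x : ℕ → G) : Prop :=
  IsPseudostring φ x ∧ Function.Injective x

/-- A string with `x₀ ≠ 0` and `φᵏ(x₀) = 0` for some `k ≥ 1`. -/
def IsNullString (φ : AddMonoid.End G) (x : ℕ → G) : Prop :=
  IsString φ x ∧ x 0 ≠ 0 ∧ ∃ k : ℕ, 0 < k ∧ φ^[k] (x 0) = 0

/-- The string number of an endomorphism: the supremum of the cardinalities of the families of
pairwise disjoint strings of `φ`. All infinite suprema are identified with `∞ = ⊤`. -/
noncomputable def endStringNumber (φ : AddMonoid.End G) : ℕ∞ :=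
  ⨆ F ∈ {F : Set (ℕ → G) | (∀ x ∈ F, IsString φ x) ∧
    F.PairwiseDisjoint (fun x => Set.range x)}, F.encard

/-- The null string number of an endomorphism: the supremum of the cardinalities of the families
of pairwise disjoint null strings of `φ`. -/
noncomputable def endNullStringNumber (φ : AddMonoid.End G) : ℕ∞ :=
  ⨆ F ∈ {F : Set (ℕ → G) | (∀ x ∈ F, IsNullString φ x) ∧
    F.PairwiseDisjoint (fun x => Set.range x)}, F.encard

variable (G)

/-- The string number `s(G)` of an abelian group. -/
noncomputable def stringNumber : ℕ∞ :=
  ⨆ φ : AddMonoid.End G, endStringNumber φ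

/-- The null string number `s₀(G)` of an abelian group. -/
noncomputable def nullStringNumber : ℕ∞ :=
  ⨆ φ : AddMonoid.End G, endNullStringNumber φ

/-- `G` is a `p`-group: the order of every element is a power of `p`. -/
def IsAbelianPGroup (p : ℕ) : Prop :=
  ∀ g : G, ∃ n : ℕ, addOrderOf g = p ^ n

/-- `G` is reduced: its only divisible subgroup is `0`. -/
def IsReducedGroup : Prop :=
  ∀ H : AddSubgroup G, (∀ n : ℕ, 0 < n → ∀ x ∈ H, ∃ y ∈ H, n • y = x) → H = ⊥

end StringNumber

namespace StringNumber

/-! A single null string forces infinitely many disjoint ones (`endNullStringNumber_eq_top`), so s₀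
is 0 or ∞. Two facts remain: an infinite p-group, hence a torsion group with an infinite p-component
(a direct summand), has a null string; a torsion group with finite p-components has no string at
all.

For an infinite p-group, suppose first that cyclic direct summands have unbounded order. With
generators c_i of fast growing orders, a pointwise finite sum of maps c_{i+1} ↦ c_i acts on the span
of the c_i as a shift up to lower terms. Otherwise p^N G = p^{N+1} G for some N. If p^N G ≠ 0,
multiplication by p has a null string there; if p^N G = 0, then G has a free ℤ/p^{k+1}-summand of
infinite rank, and the left shift on it works. The splittings come from the self-injectivity of ℤ/n
(`exists_hom_finsupp_zmod`).

When all p-components are finite, a pigeonhole argument (`IsPseudostring.eq_zero`) shows that the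
orders of the terms of a string involve only primes dividing the order of x₀, so the string lies in
a finite subgroup. -/

/-! ### Null strings and infinite disjoint families -/

theorem IsPseudostring.iterate_add {G : Type*} [AddCommGroup G] {φ : AddMonoid.End G} {x : ℕ → G}
    (hx : IsPseudostring φ x) (n m : ℕ) : φ^[n] (x (n + m)) = x m := by
  induction n with
  | zero => simp
  | succ n ih =>
    rw [Function.iterate_succ_apply, show n + 1 + m = n + m + 1 by ring, hx, ih]

theorem iterate_map_add_zero {G : Type*} [AddCommGroup G] (φ : AddMonoid.End G) (n m : ℕ) {g : G}
    (h : φ^[n] g = 0) : φ^[m + n] g = 0 := by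
  rw [Function.iterate_add_apply, h, iterate_map_zero]

/-- A pseudostring starting at a nonzero element of the kernel is a null string. -/
theorem IsPseudostring.isNullString {G : Type*} [AddCommGroup G] {φ : AddMonoid.End G} {x : ℕ → G}
    (hx : IsPseudostring φ x) (h0 : x 0 ≠ 0) (h1 : φ (x 0) = 0) : IsNullString φ x := by
  refine ⟨⟨hx, ?_⟩, h0, 1, one_pos, by simpa using h1⟩
  have key : ∀ m n : ℕ, m < n → x m ≠ x n := by
    intro m n hmn h
    obtain ⟨d, rfl⟩ := Nat.exists_eq_add_of_lt hmn
    have e1 : φ^[m] (x m) = x 0 := by simpa using hx.iterate_add m 0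
    have e2 : φ^[m + d + 1] (x (m + d + 1)) = x 0 := by simpa using hx.iterate_add (m + d + 1) 0
    rw [← h, show m + d + 1 = d + (1 + m) by ring] at e2
    rw [iterate_map_add_zero φ (1 + m) d
      (by rw [Function.iterate_add_apply, e1]; simpa using h1)] at e2
    exact h0 e2.symm
  intro m n h
  rcases lt_trichotomy m n with hmn | hmn | hmn
  · exact (key m n hmn h).elim
  · exact hmn
  · exact (key n m hmn h.symm).elim

/-- A subgroup contained in its image under `φ` contains a null string starting at any given
nonzero element of the kernel. -/
theorem exists_isNullString_of_le_map {G : Type*} [AddCommGroup G] {φ : AddMonoid.End G}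
    {H : AddSubgroup G} (hH : H ≤ H.map φ) {g : G} (hg : g ∈ H) (h0 : g ≠ 0) (h1 : φ g = 0) :
    ∃ x, IsNullString φ x := by
  choose s hs hφ using fun a : H => (AddSubgroup.mem_map.1 (hH a.2))
  let y : ℕ → H := fun n => Nat.rec (motive := fun _ => H) ⟨g, hg⟩ (fun _ a => ⟨s a, hs a⟩) n
  have hy : IsPseudostring φ (fun n => (y n : G)) := fun n => hφ (y n)
  exact ⟨_, hy.isNullString h0 h1⟩

/-- If j + 1 is the least exponent killing x₀, apply φ^j to the whole string. -/
theorem IsNullString.exists_map_eq_zero {G : Type*} [AddCommGroup G] {φ : AddMonoid.End G}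
    {x : ℕ → G} (hx : IsNullString φ x) : ∃ y, IsPseudostring φ y ∧ y 0 ≠ 0 ∧ φ (y 0) = 0 := by
  classical
  obtain ⟨⟨hp, -⟩, h0, hk⟩ := hx
  have hk' : ∃ k, φ^[k] (x 0) = 0 := hk.imp fun _ h => h.2
  obtain ⟨j, hj⟩ : ∃ j, Nat.find hk' = j + 1 :=
    Nat.exists_eq_succ_of_ne_zero fun h => h0 (by simpa [h] using Nat.find_spec hk')
  have hmin : φ^[j] (x 0) ≠ 0 := Nat.find_min hk' (by omega)
  have hz : φ^[j + 1] (x 0) = 0 := hj ▸ Nat.find_spec hk'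
  refine ⟨fun n => φ^[j] (x n), fun n => ?_, hmin, ?_⟩
  · change φ (φ^[j] (x (n + 1))) = φ^[j] (x n)
    rw [← Function.iterate_succ_apply' φ, Function.iterate_succ_apply, hp]
  · change φ (φ^[j] (x 0)) = 0
    rwa [← Function.iterate_succ_apply' φ]

/-- Normalise to φ(y₀) = 0 and take the strings n ↦ y_{n+j+1} + y_n, one for each j. The last
nonzero iterate of such an element occurs at exponent n + j + 1, which recovers that index;
cancelling recovers y_n, hence n and j. -/
theorem endNullStringNumber_eq_top {G : Type*} [AddCommGroup G] {φ : AddMonoid.End G} {x : ℕ → G}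
    (hx : IsNullString φ x) : endNullStringNumber φ = ⊤ := by
  obtain ⟨y, hy, hy0, hy1⟩ := hx.exists_map_eq_zero
  have hyn := hy.isNullString hy0 hy1
  have hinj : Function.Injective y := hyn.1.2
  have hyb : ∀ b, φ^[b] (y b) = y 0 := fun b => by simpa using hy.iterate_add b 0
  have hyz : ∀ n b, n < b → φ^[b] (y n) = 0 := fun n b h => by
    obtain ⟨d, rfl⟩ := Nat.exists_eq_add_of_lt h
    rw [show n + d + 1 = d + (1 + n) by ring]
    refine iterate_map_add_zero φ _ _ ?_
    rw [Function.iterate_add_apply, hyb]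
    simpa using hy1
  let z : ℕ → ℕ → G := fun j n => y (n + j + 1) + y n
  have htop : ∀ j n, φ^[n + j + 1] (z j n) = y 0 := fun j n => by
    simp only [z, iterate_map_add, hyb, hyz n (n + j + 1) (by omega), add_zero]
  have hbig : ∀ j n b, n + j + 1 < b → φ^[b] (z j n) = 0 := fun j n b h => by
    simp only [z, iterate_map_add, hyz _ _ h, hyz n b (by omega), add_zero]
  have hz : ∀ i j n m, z i n = z j m → i = j ∧ n = m := by
    intro i j n m h
    rcases lt_trichotomy (n + i + 1) (m + j + 1) with hlt | heq | hlt
    · exact (hy0 (by rw [← htop j m, ← h, hbig _ _ _ hlt])).elim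
    · simp only [z, heq, add_right_inj] at h
      have := hinj h
      omega
    · exact (hy0 (by rw [← htop i n, h, hbig _ _ _ hlt])).elim
  have hnull : ∀ j, IsNullString φ (z j) := fun j => by
    refine ⟨⟨fun n => ?_, fun n m h => (hz j j n m h).2⟩, fun h => ?_, j + 2, by omega,
      hbig j 0 _ (by omega)⟩
    · change φ (y (n + 1 + j + 1) + y (n + 1)) = y (n + j + 1) + y n
      rw [map_add, show n + 1 + j + 1 = (n + j + 1) + 1 by ring, hy, hy]
    · have := htop j 0
      rw [h, iterate_map_zero] at this
      exact hy0 this.symm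
  have hzinj : Function.Injective z := fun i j h => (hz i j 0 0 (congrFun h 0)).1
  refine top_le_iff.1 ?_
  rw [endNullStringNumber, ← (Set.infinite_range_of_injective hzinj).encard_eq]
  refine le_iSup₂_of_le (Set.range z) ⟨?_, ?_⟩ le_rfl
  · rintro _ ⟨j, rfl⟩
    exact hnull j
  · rintro _ ⟨i, rfl⟩ _ ⟨j, rfl⟩ hij
    refine Set.disjoint_left.2 ?_
    rintro _ ⟨n, rfl⟩ ⟨m, hm⟩
    exact hij (by rw [(hz _ _ _ _ hm).1])

theorem IsNullString.nullStringNumber_eq_top {G : Type*} [AddCommGroup G] {φ : AddMonoid.End G}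
    {x : ℕ → G} (hx : IsNullString φ x) : nullStringNumber G = ⊤ :=
  top_le_iff.1 (endNullStringNumber_eq_top hx ▸ le_iSup endNullStringNumber φ)

theorem nullStringNumber_le_stringNumber (G : Type*) [AddCommGroup G] :
    nullStringNumber G ≤ stringNumber G :=
  iSup_mono fun _ => biSup_mono fun _ hF => ⟨fun x hx => (hF.1 x hx).1, hF.2⟩

theorem stringNumber_eq_zero {G : Type*} [AddCommGroup G]
    (h : ∀ (φ : AddMonoid.End G) (x : ℕ → G), ¬ IsString φ x) : stringNumber G = 0 := by
  simp only [stringNumber, endStringNumber, ENat.iSup_eq_zero, Set.encard_eq_zero]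
  exact fun φ F hF => Set.eq_empty_of_forall_notMem fun x hx => h φ x (hF.1 x hx)

/-! ### Injectivity over ℤ/n and splitting of pure subgroups -/

/-- Baer's criterion over `ZMod n`: it suffices that elements killed by a divisor of `n` are
divisible by the complementary divisor. -/
theorem baer_zmod {n : ℕ} {Q : Type*} [AddCommGroup Q] [Module (ZMod n) Q]
    (hQ : ∀ d e : ℕ, d * e = n → ∀ q : Q, e • q = 0 → ∃ q' : Q, d • q' = q) :
    Module.Baer (ZMod n) Q := by
  have : IsPrincipalIdealRing (ZMod n) :=
    IsPrincipalIdealRing.of_surjective (Int.castRingHom (ZMod n)) (ZMod.ringHom_surjective _)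
  intro I g
  obtain ⟨a, rfl⟩ := (IsPrincipalIdealRing.principal I).principal
  obtain ⟨b, rfl⟩ := ZMod.intCast_surjective a
  have hmem : (b : ZMod n) ∈ Submodule.span (ZMod n) {(b : ZMod n)} :=
    Submodule.mem_span_singleton_self _
  obtain ⟨e, he⟩ : Int.gcd b n ∣ n := by exact_mod_cast Int.gcd_dvd_right b (n : ℤ)
  obtain ⟨c, hc⟩ : (Int.gcd b n : ℤ) ∣ b := Int.gcd_dvd_left b (n : ℤ)
  have hkill : (e : ZMod n) * b = 0 := by
    have : (e : ℤ) * b = n * c := by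
      conv_lhs => rw [hc]
      conv_rhs => rw [he]
      push_cast
      ring
    have := congrArg (Int.cast : ℤ → ZMod n) this
    simpa using this
  obtain ⟨q', hq'⟩ := hQ _ e he.symm (g ⟨_, hmem⟩) (by
    rw [← Nat.cast_smul_eq_nsmul (ZMod n), ← map_smul]
    convert map_zero g
    exact Subtype.ext hkill)
  have hbez : (b : ZMod n) * (Int.gcdA b n : ZMod n) = (Int.gcd b n : ZMod n) := by
    have := congrArg (Int.cast : ℤ → ZMod n) (Int.gcd_eq_gcd_ab b n)
    push_cast at this
    simpa using this.symm
  -- With d = gcd(b, n), g(b) = d q' and b u = d in ℤ/n, the extension is 1 ↦ u q'.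
  refine ⟨LinearMap.toSpanSingleton _ _ ((Int.gcdA b n : ZMod n) • q'), fun x hx => ?_⟩
  obtain ⟨r, rfl⟩ := Submodule.mem_span_singleton.1 hx
  rw [show (⟨r • (b : ZMod n), hx⟩ : Submodule.span (ZMod n) {(b : ZMod n)}) = r • ⟨_, hmem⟩ from rfl,
    map_smul, map_smul, ← hq', LinearMap.toSpanSingleton_apply, smul_smul (b : ZMod n), hbez,
    Nat.cast_smul_eq_nsmul]

theorem ZMod.exists_nsmul_eq {n d e : ℕ} (h : d * e = n) (hn : n ≠ 0) (a : ZMod n)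
    (ha : e • a = 0) : ∃ b : ZMod n, d • b = a := by
  obtain ⟨m, rfl⟩ := ZMod.intCast_surjective a
  have he : (e : ℤ) ≠ 0 := by rintro h'; simp_all
  have : ((e * m : ℤ) : ZMod n) = 0 := by simpa using ha
  rw [ZMod.intCast_zmod_eq_zero_iff_dvd, ← h, mul_comm d] at this
  push_cast at this
  obtain ⟨k, rfl⟩ := (mul_dvd_mul_iff_left he).1 this
  exact ⟨k, by simp⟩

theorem baer_finsupp_zmod {n : ℕ} (hn : n ≠ 0) (ι : Type*) :
    Module.Baer (ZMod n) (ι →₀ ZMod n) := by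
  refine baer_zmod fun d e h q hq => ?_
  choose! s hs using ZMod.exists_nsmul_eq h hn
  -- The chosen quotient of 0 need not be 0, so it is reset there to keep the support finite.
  refine ⟨Finsupp.onFinset q.support (fun i => if q i = 0 then 0 else s (q i)) (by
    intro i hi; simp only [Finsupp.mem_support_iff]; intro h0; simp [h0] at hi), ?_⟩
  ext i
  have hqi : e • q i = 0 := by simpa using DFunLike.congr_fun hq i
  by_cases h0 : q i = 0
  · simp [h0]
  · rw [Finsupp.smul_apply, Finsupp.onFinset_apply, if_neg h0, hs _ hqi]

/-- The homomorphism from a free `ZMod n`-module sending the basis to given elements of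
exponent `n`. -/
noncomputable def finsuppZModLift {G ι : Type*} [AddCommGroup G] (n : ℕ) (c : ι → G)
    (hc : ∀ i, n • c i = 0) : (ι →₀ ZMod n) →+ G :=
  Finsupp.liftAddHom fun i => ZMod.lift n ⟨zmultiplesHom G (c i), by simpa using hc i⟩

theorem finsuppZModLift_single {G ι : Type*} [AddCommGroup G] (n : ℕ) (c : ι → G)
    (hc : ∀ i, n • c i = 0) (i : ι) (a : ℤ) :
    finsuppZModLift n c hc (Finsupp.single i (a : ZMod n)) = a • c i := by
  simp [finsuppZModLift]

theorem finsuppZModLift_mapRange {G ι : Type*} [AddCommGroup G] (n : ℕ) (c : ι → G)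
    (hc : ∀ i, n • c i = 0) (b : ι →₀ ℤ) :
    finsuppZModLift n c hc (b.mapRange (Int.castAddHom (ZMod n)) (map_zero _)) =
      b.sum fun i a => a • c i := by
  induction b using Finsupp.induction_linear with
  | zero => simp
  | add f g hf hg =>
    rw [Finsupp.mapRange_add (by simp), map_add, hf, hg, Finsupp.sum_add_index' (by simp)
      (by intros; rw [add_smul])]
  | single i a =>
    rw [Finsupp.mapRange_single, Finsupp.sum_single_index (by simp)]
    exact finsuppZModLift_single n c hc i a

/-- Extension of homomorphisms of groups of exponent `n` along injective homomorphisms. -/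
theorem exists_hom_extension {n : ℕ} {A B Q : Type*} [AddCommGroup A] [AddCommGroup B]
    [AddCommGroup Q] [Module (ZMod n) B] [Module (ZMod n) Q] (hQ : Module.Baer (ZMod n) Q)
    (hA : ∀ a : A, n • a = 0) (f : B →+ A) (hf : Function.Injective f) (g : B →+ Q) :
    ∃ h : A →+ Q, ∀ b, h (f b) = g b := by
  let _ : Module (ZMod n) A := AddCommGroup.zmodModule hA
  obtain ⟨h, hh⟩ := hQ.extension_property (f.toZModLinearMap n) hf (g.toZModLinearMap n)
  exact ⟨h.toAddMonoidHom, fun b => LinearMap.congr_fun hh b⟩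

/-- Elements `c i` with `p ^ (k + 1) • c i = 0` such that the `p ^ k • c i` are independent
modulo `p ^ (k + 1) G` generate a free `ZMod (p ^ (k + 1))`-module which is a direct summand. -/
theorem exists_hom_finsupp_zmod {G ι : Type*} [AddCommGroup G] {p : ℕ} (hp : p ≠ 0) (k : ℕ)
    (c : ι → G) (hc : ∀ i, p ^ (k + 1) • c i = 0)
    (hind : ∀ (b : ι →₀ ℤ) (g : G), p ^ (k + 1) • g = p ^ k • (b.sum fun i a => a • c i) →
      ∀ i, (p : ℤ) ∣ b i) :
    ∃ h : G →+ (ι →₀ ZMod (p ^ (k + 1))), ∀ b, h (finsuppZModLift _ c hc b) = b := by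
  obtain ⟨n, hn⟩ : ∃ n, p ^ (k + 1) = n := ⟨_, rfl⟩
  simp only [hn] at hc hind ⊢
  let S : AddSubgroup G := (nsmulAddMonoidHom (α := G) n).range
  have hS : ∀ x : G ⧸ S, n • x = 0 := fun x => by
    induction x using QuotientAddGroup.induction_on with
    | H g => exact (QuotientAddGroup.eq_zero_iff (N := S) (n • g)).2 ⟨g, rfl⟩
  let f : (ι →₀ ZMod n) →+ G ⧸ S := (QuotientAddGroup.mk' S).comp (finsuppZModLift n c hc)
  have hf : Function.Injective f := by
    refine (injective_iff_map_eq_zero f).2 fun b hb => ?_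
    obtain ⟨g, hg⟩ := (QuotientAddGroup.eq_zero_iff (N := S) _).1 hb
    replace hg : n • g = finsuppZModLift n c hc b := hg
    obtain ⟨b, rfl⟩ := Finsupp.mapRange_surjective (Int.castAddHom (ZMod n)) (map_zero _)
      ZMod.intCast_surjective b
    rw [finsuppZModLift_mapRange] at hg
    -- Once b = p^j b'', multiplying the relation by p^{k-j} puts b'' under `hind` and gains one
    -- more factor p; at j = k + 1 the coefficients vanish mod n.
    have key : ∀ j ≤ k + 1, ∀ i, (p : ℤ) ^ j ∣ b i := by
      intro j
      induction j with
      | zero => simp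
      | succ j ih =>
        intro hj
        have hd := ih (by omega)
        choose b' hb' using hd
        have hpj : (p : ℤ) ^ j ≠ 0 := pow_ne_zero _ (by exact_mod_cast hp)
        let b'' : ι →₀ ℤ := Finsupp.onFinset b.support b' fun i hi => by
          rw [Finsupp.mem_support_iff, hb']
          exact mul_ne_zero hpj hi
        have hbb : b = (p : ℤ) ^ j • b'' := by
          ext i
          simp [b'', hb' i]
        have hsum : (b.sum fun i a => a • c i) = p ^ j • (b''.sum fun i a => a • c i) := by
          rw [hbb, Finsupp.sum_smul_index' (by simp), Finsupp.smul_sum]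
          refine Finsupp.sum_congr fun i _ => ?_
          rw [smul_assoc]
          exact_mod_cast natCast_zsmul (b'' i • c i) (p ^ j)
        have := hind b'' (p ^ (k - j) • g) (by
          rw [smul_comm, hg, hsum, smul_smul, ← pow_add, Nat.sub_add_cancel (by omega)])
        intro i
        rw [hb' i, pow_succ]
        exact mul_dvd_mul_left _ (this i)
    ext i
    simp only [Finsupp.mapRange_apply, Finsupp.coe_zero, Pi.zero_apply, Int.coe_castAddHom]
    rw [ZMod.intCast_zmod_eq_zero_iff_dvd]
    rw [← hn]
    exact_mod_cast key _ le_rfl i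
  obtain ⟨h, hh⟩ := exists_hom_extension
    (baer_finsupp_zmod (hn ▸ pow_ne_zero (k + 1) hp) ι) hS f hf (AddMonoidHom.id _)
  subst hn
  exact ⟨h.comp (QuotientAddGroup.mk' S), hh⟩

/-- Let `⟨c'⟩` be a pure cyclic subgroup of order `p ^ (k' + 1)` and `c` an element killed by
`p ^ (k + 1)` with `k ≤ k'`. Then `G` has an endomorphism with values in `⟨c⟩`, sending `c'` to `c`
and killing the elements killed by `p ^ (k' - k)`. -/
theorem exists_hom_zmultiples {G : Type*} [AddCommGroup G] {p : ℕ} (hp : p.Prime) {k k' : ℕ}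
    (hk : k ≤ k') {c c' : G} (hc : p ^ (k + 1) • c = 0) (hc' : p ^ (k' + 1) • c' = 0)
    (hpure : ∀ g : G, p ^ (k' + 1) • g ≠ p ^ k' • c') :
    ∃ θ : G →+ G, θ c' = c ∧ (∀ g, θ g ∈ AddSubgroup.zmultiples c) ∧
      ∀ t, t + k ≤ k' → ∀ g, p ^ t • g = 0 → θ g = 0 := by
  obtain ⟨h, hh⟩ := exists_hom_finsupp_zmod hp.ne_zero k' (fun _ : Unit => c') (fun _ => hc') (by
    rintro b g hg ⟨⟩
    by_contra hdvd
    obtain ⟨u, v, huv⟩ := (Nat.prime_iff_prime_int.1 hp).coprime_iff_not_dvd.2 hdvd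
    have hsum : (b.sum fun _ a => a • c') = b () • c' := by
      rw [Finsupp.sum_fintype _ _ (by simp), Fintype.sum_unique]
    refine hpure (v • g) ?_
    rw [smul_comm, hg, hsum, smul_comm, smul_smul v,
      show v * b () = 1 - u * p by linear_combination huv, sub_smul, one_smul, smul_sub, mul_smul,
      smul_comm _ u, natCast_zsmul, smul_smul (p ^ k'), ← pow_succ, hc', smul_zero, sub_zero])
  have hc2 : p ^ (k' + 1) • c = 0 := by
    rw [show k' + 1 = (k' - k) + (k + 1) by omega, pow_add, mul_smul, hc, smul_zero]
  let l := finsuppZModLift (p ^ (k' + 1)) (fun _ : Unit => c) (fun _ => hc2)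
  have hl : ∀ q, ∃ a : ℤ, q = Finsupp.single () (a : ZMod (p ^ (k' + 1))) := fun q => by
    obtain ⟨a, ha⟩ := ZMod.intCast_surjective (q ())
    exact ⟨a, by ext; simp [ha]⟩
  have hls : ∀ a : ℤ, l (Finsupp.single () (a : ZMod _)) = a • c := fun a =>
    finsuppZModLift_single _ _ (fun _ => hc2) () a
  refine ⟨l.comp h, ?_, fun g => ?_, fun t ht g hg => ?_⟩
  · have := hh (Finsupp.single () ((1 : ℤ) : ZMod _))
    rw [finsuppZModLift_single, one_smul] at this
    rw [AddMonoidHom.comp_apply, this, hls, one_smul]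
  · obtain ⟨a, ha⟩ := hl (h g)
    rw [AddMonoidHom.comp_apply, ha, hls]
    exact ⟨a, rfl⟩
  · obtain ⟨a, ha⟩ := hl (h g)
    have h1 : p ^ t • h g = 0 := by rw [← map_nsmul, hg, map_zero]
    have h2 : ((p ^ t * a : ℤ) : ZMod (p ^ (k' + 1))) = 0 := by
      have := DFunLike.congr_fun h1 ()
      rw [ha] at this
      simpa using this
    rw [ZMod.intCast_zmod_eq_zero_iff_dvd, show k' + 1 = t + (k' + 1 - t) by omega, pow_add] at h2
    push_cast at h2
    obtain ⟨m, rfl⟩ :=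
      (mul_dvd_mul_iff_left (pow_ne_zero t (by exact_mod_cast hp.ne_zero))).1 h2
    rw [AddMonoidHom.comp_apply, ha, hls, show k' + 1 - t = (k' - t - k) + (k + 1) by omega, pow_add,
      mul_comm, ← mul_assoc, mul_smul, show ((p : ℤ) ^ (k + 1)) = ((p ^ (k + 1) : ℕ) : ℤ) by simp,
      natCast_zsmul, hc, smul_zero]

/-! ### Infinite p-groups: cyclic summands of unbounded order -/

/-- The sum of a pointwise finite family of homomorphisms. -/
noncomputable def finsumHom {G : Type*} [AddCommGroup G] (θ : ℕ → G →+ G)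
    (h : ∀ g, (Function.support fun i => θ i g).Finite) : AddMonoid.End G :=
  AddMonoidHom.mk' (fun g => ∑ᶠ i, θ i g) fun a b => by
    simp only [map_add]
    exact finsum_add_distrib (h a) (h b)

/-- If the `p ^ k`-multiples of elements of order `p ^ (k + 1)` have finite height `k` for
arbitrarily large `k`, then there is a null string. -/
theorem exists_isNullString_of_unbounded {G : Type*} [AddCommGroup G] {p : ℕ} (hp : p.Prime)
    (hG : ∀ g : G, ∃ t, p ^ t • g = 0)
    (hub : ∀ N, ∃ k ≥ N, ∃ c : G, p ^ (k + 1) • c = 0 ∧ ∀ g : G, p ^ (k + 1) • g ≠ p ^ k • c) :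
    ∃ (φ : AddMonoid.End G) (x : ℕ → G), IsNullString φ x := by
  choose K hK C hC hpure using hub
  -- This recursion forces k_{i+1} ≥ 2 k_i + 1, so that θ_i kills c_j for all j ≤ i, and kills any
  -- given element once i is large.
  let r : ℕ → ℕ := fun i => Nat.rec 0 (fun _ N => 2 * K N + 1) i
  let k : ℕ → ℕ := fun i => K (r i)
  let c : ℕ → G := fun i => C (r i)
  have hk : ∀ i, 2 * k i + 1 ≤ k (i + 1) := fun i => hK (r (i + 1))
  have hc : ∀ i, p ^ (k i + 1) • c i = 0 := fun i => hC _
  have hmono : Monotone k := monotone_nat_of_le_succ fun i => by have := hk i; omega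
  have hle : ∀ i, i ≤ k i := fun i => by
    induction i with
    | zero => exact Nat.zero_le _
    | succ i ih => have := hk i; omega
  choose θ hθ hrange hkill using fun i =>
    exists_hom_zmultiples (k := k i) (k' := k (i + 1)) hp (hmono i.le_succ) (hc i) (hc (i + 1)) (hpure _)
  have hfin : ∀ g, (Function.support fun i => θ i g).Finite := fun g => by
    obtain ⟨t, ht⟩ := hG g
    refine (Set.finite_lt_nat t).subset fun i hi => ?_
    by_contra hit
    have h1 := hk i
    have h2 := hle i
    simp only [Set.mem_ofPred_eq] at hit
    exact hi (hkill i t (by omega) g ht)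
  have hzero : ∀ i j, j ≤ i → θ i (c j) = 0 := fun i j hij => by
    have h1 := hk i
    have h2 := hmono hij
    exact hkill i (k j + 1) (by omega) _ (hc j)
  let f := finsumHom θ hfin
  have hf : ∀ i, f (c i) = ∑ j ∈ Finset.range i, θ j (c i) := fun i =>
    finsum_eq_sum_of_support_subset _ fun j hj => by
      by_contra hji
      exact hj (hzero j i (by simpa using hji))
  let H : ℕ → AddSubgroup G := fun i => AddSubgroup.closure (c '' Set.Iio i)
  have hmem : ∀ {j i}, j < i → c j ∈ H i := fun h => AddSubgroup.subset_closure ⟨_, h, rfl⟩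
  have hHmono : Monotone H := fun i j hij =>
    AddSubgroup.closure_mono (Set.image_mono (Set.Iio_subset_Iio hij))
  have hH : ∀ i, H i ≤ (H (i + 1)).map f := by
    intro i
    induction i with
    | zero => simp [H]
    | succ i ih =>
      refine (AddSubgroup.closure_le _).2 ?_
      rintro _ ⟨j, hj, rfl⟩
      have hm : (H (i + 1)).map f ≤ (H (i + 1 + 1)).map f :=
        AddSubgroup.map_mono (hHmono (Nat.le_succ _))
      rcases (Nat.lt_succ_iff_lt_or_eq.1 hj) with hj | rfl
      · exact hm (ih (hmem hj))
      -- Here f(c_{j+1}) is c_j plus an error in the span of the c_i with i < j, which the induction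
      -- hypothesis already places in the image.
      · have hs : ∑ i ∈ Finset.range j, θ i (c (j + 1)) ∈ H j := by
          refine sum_mem fun i hi => ?_
          exact (AddSubgroup.zmultiples_le.2 (hmem (Finset.mem_range.1 hi))) (hrange i _)
        have he : c j = f (c (j + 1)) - ∑ i ∈ Finset.range j, θ i (c (j + 1)) := by
          rw [hf (j + 1), Finset.sum_range_succ, hθ, add_sub_cancel_left]
        rw [he]
        exact sub_mem (AddSubgroup.mem_map_of_mem _ (hmem (Nat.lt_succ_self _))) (hm (ih hs))
  have hc0 : c 0 ≠ 0 := fun h => hpure (r 0) 0 (by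
    change _ = p ^ k 0 • c 0
    rw [h, smul_zero, smul_zero])
  refine ⟨f, exists_isNullString_of_le_map (H := ⨆ i, H i) ?_ (AddSubgroup.mem_iSup_of_mem 1
    (hmem one_pos)) hc0 (by simp [hf])⟩
  exact iSup_le fun i => (hH i).trans (AddSubgroup.map_mono (le_iSup H _))

/-! ### Infinite p-groups of finite exponent -/

theorem exists_linearIndependent_nat (F U : Type*) [Field F] [Finite F] [AddCommGroup U]
    [Module F U] [Infinite U] : ∃ u : ℕ → U, LinearIndependent F u := by
  let B := Module.Basis.ofVectorSpace F U
  have hidx : Infinite (Module.Basis.ofVectorSpaceIndex F U) := by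
    by_contra h
    have := not_infinite_iff_finite.1 h
    have := Module.Finite.of_basis B
    exact Infinite.not_finite (Module.finite_of_finite F : Finite U)
  let e := Infinite.natEmbedding (Module.Basis.ofVectorSpaceIndex F U)
  exact ⟨_, B.linearIndependent.comp e e.injective⟩

/-- An infinite elementary abelian `p`-group contains an independent sequence. -/
theorem exists_independent_seq {U : Type*} [AddCommGroup U] [Infinite U] {p : ℕ} (hp : p.Prime)
    (hU : ∀ x : U, p • x = 0) :
    ∃ u : ℕ → U, ∀ b : ℕ →₀ ℤ, ∑ i ∈ b.support, b i • u i = 0 → ∀ i, (p : ℤ) ∣ b i := by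
  have : Fact p.Prime := ⟨hp⟩
  let _ : Module (ZMod p) U := AddCommGroup.zmodModule hU
  obtain ⟨u, hli⟩ := exists_linearIndependent_nat (ZMod p) U
  refine ⟨u, fun b hb i => ?_⟩
  by_cases hi : i ∈ b.support
  · refine (ZMod.intCast_zmod_eq_zero_iff_dvd _ _).1
      (linearIndependent_iff'.1 hli b.support (fun i => (b i : ZMod p)) ?_ i hi)
    rw [← hb]
    exact Finset.sum_congr rfl fun i _ => Int.cast_smul_eq_zsmul _ _ _
  · simp [Finsupp.notMem_support_iff.1 hi]

/-- An infinite abelian `p`-group of finite exponent has an endomorphism with a null string. -/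
theorem exists_isNullString_of_bounded {G : Type*} [AddCommGroup G] [Infinite G] {p : ℕ}
    (hp : p.Prime) {N : ℕ} (hN : ∀ g : G, p ^ N • g = 0) :
    ∃ (φ : AddMonoid.End G) (x : ℕ → G), IsNullString φ x := by
  classical
  let D : ℕ → AddSubgroup G := fun k => (nsmulAddMonoidHom (α := G) (p ^ k)).range
  have hex : ∃ k, Finite (D k) := ⟨N, by
    have : D N = ⊥ := by
      rw [eq_bot_iff]
      rintro _ ⟨g, rfl⟩
      exact hN g
    rw [this]
    infer_instance⟩
  obtain ⟨k, hk⟩ : ∃ k, Nat.find hex = k + 1 := Nat.exists_eq_succ_of_ne_zero fun h0 => by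
    have := Nat.find_spec hex
    rw [h0] at this
    have hD0 : D 0 = ⊤ := by
      rw [eq_top_iff]
      exact fun g _ => ⟨g, by simp⟩
    rw [hD0] at this
    exact Infinite.not_finite (Finite.of_equiv _ AddSubgroup.topEquiv.toEquiv : Finite G)
  have hfin : Finite (D (k + 1)) := hk ▸ Nat.find_spec hex
  have hinf : ¬ Finite (D k) := Nat.find_min hex (by omega)
  -- the socle of `p ^ k G`
  let V : AddSubgroup G := D k ⊓ (nsmulAddMonoidHom (α := G) p).ker
  -- Multiplication by p maps p^k G into the finite group p^{k+1} G, so its kernel V on p^k G must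
  -- be infinite.
  have hV : ¬ Finite V := fun hV => hinf <| by
    let m : D k →+ D (k + 1) := ((nsmulAddMonoidHom (α := G) p).comp (D k).subtype).codRestrict _ <| by
      rintro ⟨_, g, rfl⟩
      exact ⟨g, by simp [pow_succ', mul_smul]⟩
    have hker : Finite m.ker := by
      refine Finite.of_injective (β := V) (fun x => ⟨x.1.1, x.1.2, ?_⟩) fun x y h => ?_
      · exact congrArg Subtype.val x.2
      · exact Subtype.ext (Subtype.ext (Subtype.mk.inj h))
    have : Finite (D k ⧸ m.ker) :=
      Finite.of_equiv _ (QuotientAddGroup.quotientKerEquivRange m).symm.toEquiv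
    exact Finite.of_equiv _ (AddSubgroup.addGroupEquivQuotientProdAddSubgroup (s := m.ker)).symm
  let W : AddSubgroup V := (D (k + 1)).addSubgroupOf V
  have hW : Finite W := Finite.of_injective (β := D (k + 1)) (fun x => ⟨x.1.1, x.2⟩) fun x y h =>
    Subtype.ext (Subtype.ext (Subtype.mk.inj h))
  have hVW : ¬ Finite (V ⧸ W) := fun h =>
    hV (Finite.of_equiv _ (AddSubgroup.addGroupEquivQuotientProdAddSubgroup (s := W)).symm)
  have : Infinite (V ⧸ W) := not_finite_iff_infinite.1 hVW
  obtain ⟨u, hu⟩ := exists_independent_seq (U := V ⧸ W) hp fun x => by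
    induction x using QuotientAddGroup.induction_on with
    | H g => exact congrArg (QuotientAddGroup.mk' W) (Subtype.ext g.2.2 : p • g = 0)
  choose v hv using fun i => QuotientAddGroup.mk'_surjective W (u i)
  choose c hc using fun i => (v i).2.1
  have hc' : ∀ i, p ^ (k + 1) • c i = 0 := fun i => by
    have : p • (v i : G) = 0 := (v i).2.2
    rw [pow_succ', mul_smul]
    rwa [← hc i] at this
  have hind : ∀ (b : ℕ →₀ ℤ) (g : G), p ^ (k + 1) • g = p ^ k • (b.sum fun i a => a • c i) →
      ∀ i, (p : ℤ) ∣ b i := by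
    intro b g hg
    have hsum : p ^ k • (b.sum fun i a => a • c i) = ((∑ i ∈ b.support, b i • v i : V) : G) := by
      rw [Finsupp.sum, Finset.smul_sum, AddSubgroup.val_finsetSum]
      refine Finset.sum_congr rfl fun i _ => ?_
      rw [smul_comm, AddSubgroup.coe_zsmul, ← hc i]
      rfl
    have h0 : QuotientAddGroup.mk' W (∑ i ∈ b.support, b i • v i) = 0 :=
      (QuotientAddGroup.eq_zero_iff _).2 ⟨g, hg.trans hsum⟩
    refine hu b ?_
    rw [← h0, map_sum]
    refine Finset.sum_congr rfl fun i _ => ?_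
    rw [map_zsmul, hv]
  obtain ⟨h, hh⟩ := exists_hom_finsupp_zmod hp.ne_zero k c hc' hind
  let l := finsuppZModLift _ c hc'
  -- Project onto the free summand, then shift left: c_{i+1} ↦ c_i and c_0 ↦ 0.
  let φ : AddMonoid.End G :=
    l.comp ((Finsupp.comapDomain.addMonoidHom Nat.succ_injective).comp h)
  have hone : ∀ i, l (Finsupp.single i 1) = c i := fun i => by
    simpa using finsuppZModLift_single _ c hc' i 1
  have hφ : ∀ b, φ (l b) = l (Finsupp.comapDomain.addMonoidHom Nat.succ_injective b) := fun b =>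
    congrArg (fun x => l (Finsupp.comapDomain.addMonoidHom Nat.succ_injective x)) (hh b)
  refine ⟨φ, c, IsPseudostring.isNullString (fun i => ?_) (fun h0 => ?_) ?_⟩
  · rw [← hone, ← hone, hφ]
    congr 1
    ext j
    simp [Finsupp.single_apply]
  · have h1 : u 0 = 0 := by
      rw [← hv, show v 0 = 0 from Subtype.ext (by rw [← hc 0, h0]; simp), map_zero]
    have := hu (Finsupp.single 0 1) (by simp [h1]) 0
    rw [Finsupp.single_eq_same] at this
    exact (Nat.prime_iff_prime_int.1 hp).not_dvd_one this
  · rw [← hone, hφ]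
    convert map_zero l
    ext j
    simp

/-! ### Arbitrary infinite p-groups -/

/-- An infinite abelian `p`-group has an endomorphism with a null string. -/
theorem exists_isNullString_of_infinite {G : Type*} [AddCommGroup G] [Infinite G] {p : ℕ}
    (hp : p.Prime) (hG : ∀ g : G, ∃ t, p ^ t • g = 0) :
    ∃ (φ : AddMonoid.End G) (x : ℕ → G), IsNullString φ x := by
  by_cases hub : ∀ N, ∃ k ≥ N, ∃ c : G, p ^ (k + 1) • c = 0 ∧
      ∀ g : G, p ^ (k + 1) • g ≠ p ^ k • c
  · exact exists_isNullString_of_unbounded hp hG hub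
  push Not at hub
  obtain ⟨N, hN⟩ := hub
  let D : AddSubgroup G := (nsmulAddMonoidHom (α := G) (p ^ N)).range
  have hdiv : ∀ t, ∀ y : G, p ^ t • p ^ N • y = 0 → ∃ z : G, p • p ^ N • z = p ^ N • y := by
    intro t
    induction t with
    | zero => exact fun y hy => ⟨0, by simpa using hy.symm⟩
    | succ t ih =>
      intro y hy
      -- Since p^{N+t+1} z = p^{N+t} y, the element p^N (y - p z) is already killed by p^t.
      obtain ⟨z, hz⟩ := hN (N + t) (by omega) y (by
        rw [smul_smul, ← pow_add] at hy
        rwa [show N + t + 1 = t + 1 + N by ring])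
      obtain ⟨w, hw⟩ := ih (y - p • z) (by
        rw [smul_smul, ← pow_add, smul_sub, smul_smul, ← pow_succ, add_comm t N, hz, sub_self])
      refine ⟨w + z, ?_⟩
      rw [smul_add, smul_add, hw, smul_sub, smul_comm p, sub_add_cancel]
  by_cases hD : ∀ g : G, p ^ N • g = 0
  · exact exists_isNullString_of_bounded hp hD
  push Not at hD
  classical
  obtain ⟨g, hg⟩ := hD
  obtain ⟨j, hj⟩ : ∃ j, Nat.find (hG (p ^ N • g)) = j + 1 :=
    Nat.exists_eq_succ_of_ne_zero fun h => hg (by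
      have := Nat.find_spec (hG (p ^ N • g))
      rwa [h, pow_zero, one_smul] at this)
  have h0 : p ^ j • p ^ N • g ≠ 0 := Nat.find_min (hG (p ^ N • g)) (by omega)
  have h1 : p • p ^ j • p ^ N • g = 0 := by
    rw [smul_smul, ← pow_succ', ← hj]
    exact Nat.find_spec (hG (p ^ N • g))
  refine ⟨nsmulAddMonoidHom (α := G) p, exists_isNullString_of_le_map (H := D) ?_
    (g := p ^ j • p ^ N • g) ⟨p ^ j • g, smul_comm _ _ _⟩ h0 h1⟩
  rintro _ ⟨y, rfl⟩
  obtain ⟨t, ht⟩ := hG (p ^ N • y)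
  obtain ⟨z, hz⟩ := hdiv t y ht
  exact ⟨p ^ N • z, ⟨z, rfl⟩, hz⟩

/-! ### Torsion groups and their primary components -/

/-- The subgroup of the elements killed by a power of `m`. -/
def powTorsion (G : Type*) [AddCommGroup G] (m : ℕ) : AddSubgroup G where
  carrier := {g | ∃ k : ℕ, m ^ k • g = 0}
  zero_mem' := ⟨0, by simp⟩
  add_mem' := by
    rintro a b ⟨i, hi⟩ ⟨j, hj⟩
    refine ⟨i + j, ?_⟩
    rw [smul_add, pow_add, mul_smul _ _ b, hj, mul_comm, mul_smul, hi, smul_zero, smul_zero,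
      add_zero]
  neg_mem' := by
    rintro a ⟨i, hi⟩
    exact ⟨i, by rw [smul_neg, hi, neg_zero]⟩

/-- For coprime a and b, Bézout splits an element killed by (ab)^k into parts killed by a^k and b^k.
-/
theorem finite_powTorsion {G : Type*} [AddCommGroup G]
    (h : ∀ p : ℕ, p.Prime → Finite (powTorsion G p)) {m : ℕ} (hm : m ≠ 0) :
    Finite (powTorsion G m) := by
  induction m using Nat.recOnPrimeCoprime with
  | zero => exact absurd rfl hm
  | prime_pow p n hp =>
    have := h p hp
    refine Finite.Set.subset (powTorsion G p : Set G) ?_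
    rintro g ⟨k, hk⟩
    exact ⟨n * k, by rwa [pow_mul]⟩
  | coprime a b ha hb hab iha ihb =>
    have := iha (by omega)
    have := ihb (by omega)
    have hfin : (Set.image2 (· + ·) (powTorsion G a : Set G) (powTorsion G b : Set G)).Finite :=
      Set.Finite.image2 _ (Set.toFinite _) (Set.toFinite _)
    refine (hfin.subset ?_).to_subtype
    rintro g ⟨k, hk⟩
    obtain ⟨u, v, huv⟩ := Nat.isCoprime_iff_coprime.2 (Nat.Coprime.pow k k hab)
    refine ⟨v • b ^ k • g, ⟨k, ?_⟩, u • a ^ k • g, ⟨k, ?_⟩, ?_⟩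
    · rw [smul_comm, smul_smul (a ^ k), ← mul_pow, hk, smul_zero]
    · rw [smul_comm, smul_smul (b ^ k), ← mul_pow, mul_comm, hk, smul_zero]
    · change v • b ^ k • g + u • a ^ k • g = g
      rw [← natCast_zsmul, ← natCast_zsmul, smul_smul, smul_smul, ← add_smul, add_comm, huv,
        one_smul]

/-- In a torsion group every element `g` has an integral multiple in the `p`-component, such that
the same multiplication fixes the elements of order `p`. -/
theorem exists_nsmul_mem_powTorsion {G : Type*} [AddCommGroup G] (hG : IsAddTorsion G) {p : ℕ}
    (hp : p.Prime) (g : G) :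
    ∃ a : ℤ, a • g ∈ powTorsion G p ∧ ∀ y : G, p • y = 0 → a • y = y := by
  obtain ⟨e, r, hr, her⟩ :=
    Nat.exists_eq_pow_mul_and_not_dvd (addOrderOf_pos_iff.2 (hG g)).ne' p hp.ne_one
  obtain ⟨u, v, huv⟩ := Nat.isCoprime_iff_coprime.2 ((Nat.Prime.coprime_iff_not_dvd hp).2 hr)
  -- With u p + v r = 1, the integer v r kills the prime-to-p part of g and is 1 modulo p.
  refine ⟨v * r, ⟨e, ?_⟩, fun y hy => ?_⟩
  · rw [mul_smul, smul_comm, natCast_zsmul, smul_smul (p ^ e), ← her, addOrderOf_nsmul_eq_zero,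
      smul_zero]
  · rw [show v * r = 1 - u * p by linear_combination huv, sub_smul, mul_smul, natCast_zsmul, hy,
      smul_zero, sub_zero, one_smul]

/-- In a torsion group with finite `p`-component, a pseudostring of elements of order `p` starting
at `0` vanishes. -/
theorem IsPseudostring.eq_zero {G : Type*} [AddCommGroup G] (hG : IsAddTorsion G) {p : ℕ}
    (hp : p.Prime) [Finite (powTorsion G p)] {φ : AddMonoid.End G} {y : ℕ → G}
    (hy : IsPseudostring φ y) (h0 : y 0 = 0) {n : ℕ} (hn : p • y n = 0) : y n = 0 := by
  -- Every iterate φ^m has a preimage of y_n inside the finite p-component: the p-part of y_{m+n}.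
  have hw : ∀ m, ∃ w ∈ powTorsion G p, φ^[m] w = y n := fun m => by
    obtain ⟨a, ha, hfix⟩ := exists_nsmul_mem_powTorsion hG hp (y (m + n))
    refine ⟨_, ha, ?_⟩
    rw [iterate_map_zsmul, hy.iterate_add, hfix _ hn]
  choose w hw hwn using hw
  have hnz : φ^[n] (y n) = 0 := by simpa [h0] using hy.iterate_add n 0
  -- A coincidence w_i = w_j makes y_n periodic under φ, while φ^n(y_n) = y_0 = 0.
  have key : ∀ i j, i < j → w i = w j → y n = 0 := by
    intro i j hij h
    have hper : φ^[j - i] (y n) = y n := by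
      conv_lhs => rw [← hwn i, ← Function.iterate_add_apply, h, Nat.sub_add_cancel hij.le, hwn]
    have hfix : φ^[(j - i) * n] (y n) = y n := by
      rw [Function.iterate_mul]
      exact Function.iterate_fixed hper n
    obtain ⟨d, hd⟩ := Nat.exists_eq_add_of_le' (Nat.le_mul_of_pos_left n (Nat.sub_pos_of_lt hij))
    rw [← hfix, hd, iterate_map_add_zero φ _ _ hnz]
  obtain ⟨i, j, hij, h⟩ := Finite.exists_ne_map_eq_of_infinite
    (fun m : ℕ => (⟨w m, hw m⟩ : powTorsion G p))
  have h' : w i = w j := congrArg Subtype.val h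
  rcases hij.lt_or_gt with hlt | hlt
  · exact key i j hlt h'
  · exact key j i hlt h'.symm

/-- The exponent m is crude but enough: each p-adic valuation of m is below m. -/
theorem dvd_pow_of_forall_prime_dvd {m n : ℕ} (hm : m ≠ 0) (hn : n ≠ 0)
    (h : ∀ p : ℕ, p.Prime → p ∣ m → p ∣ n) : m ∣ n ^ m := by
  rw [← Nat.factorization_prime_le_iff_dvd hm (pow_ne_zero _ hn)]
  intro p hp
  rw [Nat.factorization_pow, Finsupp.smul_apply, smul_eq_mul]
  by_cases hpm : p ∣ m
  · exact (Nat.factorization_lt p hm).le.trans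
      (Nat.le_mul_of_pos_right _ (hp.factorization_pos_of_dvd hn (h p hp hpm)))
  · simp [Nat.factorization_eq_zero_of_not_dvd hpm]

theorem not_isString_of_isAddTorsion {G : Type*} [AddCommGroup G] (hG : IsAddTorsion G)
    (h : ∀ p : ℕ, p.Prime → Finite (powTorsion G p)) (φ : AddMonoid.End G) (x : ℕ → G) :
    ¬ IsString φ x := by
  rintro ⟨hx, hinj⟩
  have hpos : ∀ n, 0 < addOrderOf (x n) := fun n => addOrderOf_pos_iff.2 (hG _)
  have := finite_powTorsion h (hpos 0).ne'
  have hmem : ∀ n, x n ∈ powTorsion G (addOrderOf (x 0)) := by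
    intro n
    have hprime : ∀ p : ℕ, p.Prime → p ∣ addOrderOf (x n) → p ∣ addOrderOf (x 0) := by
      intro p hp hdvd
      -- Write the order of x_n as p c. Then c x_n has order p, while c x_0, killed by p, vanishes
      -- because p does not divide the order of x_0. So `IsPseudostring.eq_zero` applies to the
      -- multiples c x_m.
      by_contra hndvd
      have := h p hp
      obtain ⟨c, hc⟩ := hdvd
      have hcx : p • c • x n = 0 := by rw [smul_smul, ← hc, addOrderOf_nsmul_eq_zero]
      have hc0 : c • x 0 = 0 := by
        have hpc : p • c • x 0 = 0 := by
          have := hx.iterate_add n 0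
          rw [add_zero] at this
          rw [← this, ← iterate_map_nsmul, ← iterate_map_nsmul, hcx, iterate_map_zero]
        by_contra hne
        have := addOrderOf_dvd_of_nsmul_eq_zero hpc
        rcases (Nat.dvd_prime hp).1 this with h1 | h1
        · exact hne (AddMonoid.addOrderOf_eq_one_iff.1 h1)
        · exact hndvd (h1 ▸ addOrderOf_smul_dvd c)
      have hy : IsPseudostring φ (fun m => c • x m) := fun m => by
        change φ (c • x (m + 1)) = c • x m
        rw [map_nsmul, hx]
      have hzero : c • x n = 0 := hy.eq_zero hG hp hc0 hcx
      have hcpos : 0 < c := Nat.pos_of_ne_zero fun h0 => (hpos n).ne' (by rw [hc, h0, mul_zero])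
      have hle := Nat.le_of_dvd hcpos (addOrderOf_dvd_of_nsmul_eq_zero hzero)
      rw [hc] at hle
      nlinarith [hp.two_le]
    exact ⟨_, addOrderOf_dvd_iff_nsmul_eq_zero.1
      (dvd_pow_of_forall_prime_dvd (hpos n).ne' (hpos 0).ne' hprime)⟩
  exact Infinite.not_finite (Finite.of_injective
    (fun n => (⟨x n, hmem n⟩ : powTorsion G (addOrderOf (x 0))))
    fun i j hij => hinj (congrArg Subtype.val hij))

/-- The `p`-component of a torsion group is a direct summand. -/
theorem exists_retraction_powTorsion {G : Type*} [AddCommGroup G] (hG : IsAddTorsion G) {p : ℕ}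
    (hp : p.Prime) : ∃ π : G →+ powTorsion G p, ∀ g : powTorsion G p, π g = g := by
  let T : Submodule ℤ G := AddSubgroup.toIntSubmodule (powTorsion G p)
  let T' : AddSubgroup G :=
    { carrier := {g | ∃ m : ℕ, p.Coprime m ∧ m • g = 0}
      zero_mem' := ⟨1, by simp, by simp⟩
      add_mem' := by
        rintro a b ⟨i, hi, hia⟩ ⟨j, hj, hjb⟩
        refine ⟨i * j, hi.mul_right hj, ?_⟩
        rw [smul_add, mul_smul, mul_smul, hjb, smul_comm, hia, smul_zero, smul_zero, add_zero]
      neg_mem' := by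
        rintro a ⟨i, hi, hia⟩
        exact ⟨i, hi, by rw [smul_neg, hia, neg_zero]⟩ }
  have hcompl : IsCompl T (AddSubgroup.toIntSubmodule T') := by
    refine ⟨Submodule.disjoint_def.2 ?_, codisjoint_iff_le_sup.2 fun g _ => ?_⟩
    · rintro g ⟨k, hk⟩ ⟨m, hm, hmg⟩
      have := Nat.eq_one_of_dvd_coprimes (hm.pow_left k) (addOrderOf_dvd_of_nsmul_eq_zero hk)
        (addOrderOf_dvd_of_nsmul_eq_zero hmg)
      exact AddMonoid.addOrderOf_eq_one_iff.1 this
    · obtain ⟨e, r, hr, her⟩ :=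
        Nat.exists_eq_pow_mul_and_not_dvd (addOrderOf_pos_iff.2 (hG g)).ne' p hp.ne_one
      have hcop := (Nat.Prime.coprime_iff_not_dvd hp).2 hr
      obtain ⟨u, v, huv⟩ := Nat.isCoprime_iff_coprime.2 (hcop.pow_left e)
      refine Submodule.mem_sup.2 ⟨v • r • g, ⟨e, ?_⟩, u • p ^ e • g, ⟨r, hcop, ?_⟩, ?_⟩
      · rw [smul_comm, smul_smul (p ^ e), ← her, addOrderOf_nsmul_eq_zero, smul_zero]
      · rw [smul_comm, smul_smul r, mul_comm, ← her, addOrderOf_nsmul_eq_zero, smul_zero]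
      · rw [← natCast_zsmul, ← natCast_zsmul, smul_smul, smul_smul, ← add_smul, add_comm, huv,
          one_smul]
  exact ⟨(T.projectionOnto _ hcompl).toAddMonoidHom, fun g =>
    Submodule.projectionOnto_apply_left hcompl g⟩

theorem exists_isNullString_of_infinite_powTorsion {G : Type*} [AddCommGroup G]
    (hG : IsAddTorsion G) {p : ℕ} (hp : p.Prime) [Infinite (powTorsion G p)] :
    ∃ (φ : AddMonoid.End G) (x : ℕ → G), IsNullString φ x := by
  obtain ⟨φ, x, hx⟩ := exists_isNullString_of_infinite (G := powTorsion G p) hp fun g => by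
    obtain ⟨k, hk⟩ := g.2
    exact ⟨k, Subtype.ext hk⟩
  obtain ⟨y, hy, h0, h1⟩ := hx.exists_map_eq_zero
  obtain ⟨π, hπ⟩ := exists_retraction_powTorsion hG hp
  let ψ : AddMonoid.End G := (powTorsion G p).subtype.comp ((φ : _ →+ _).comp π)
  have hψ : ∀ g : powTorsion G p, ψ g = φ g := fun g => by
    change ((φ (π g) : powTorsion G p) : G) = _
    rw [hπ]
  have hy' : IsPseudostring ψ (fun n => (y n : G)) := fun n => by
    change ψ (y (n + 1)) = y n
    rw [hψ, hy]
  exact ⟨ψ, _, hy'.isNullString (fun h => h0 (Subtype.ext h)) (by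
    rw [hψ, h1]; rfl)⟩

end StringNumber

theorem theorem3p5 :
    (∀ (p : ℕ) [Fact p.Prime] (G : Type*) [AddCommGroup G],
      StringNumber.IsAbelianPGroup G p → StringNumber.IsReducedGroup G →
        List.TFAE
          [StringNumber.stringNumber G = 0,
           StringNumber.nullStringNumber G = 0,
           Finite G] ∧
        StringNumber.stringNumber G = StringNumber.nullStringNumber G) ∧
    (∀ (G : Type*) [AddCommGroup G], IsAddTorsion G →
        List.TFAE
          [StringNumber.stringNumber G = 0,
           StringNumber.nullStringNumber G = 0,
           ∀ p : ℕ, p.Prime → Finite (AddCommGroup.primaryComponent G p)]) := by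
  constructor
  · intro p _ G _ hG _
    have hp : p.Prime := Fact.out
    have hle := StringNumber.nullStringNumber_le_stringNumber G
    rcases finite_or_infinite G with hfin | hinf
    · have hs := StringNumber.stringNumber_eq_zero (G := G) fun φ x hx =>
        Infinite.not_finite (Finite.of_injective x hx.2)
      have hs0 : StringNumber.nullStringNumber G = 0 := le_zero_iff.1 (hs ▸ hle)
      simp [hs, hs0, hfin]
    · obtain ⟨φ, x, hx⟩ := StringNumber.exists_isNullString_of_infinite hp fun g => by
        obtain ⟨n, hn⟩ := hG g
        exact ⟨n, hn ▸ addOrderOf_nsmul_eq_zero g⟩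
      have hs0 := hx.nullStringNumber_eq_top
      have hs : StringNumber.stringNumber G = ⊤ := top_le_iff.1 (hs0 ▸ hle)
      have := not_finite_iff_infinite.2 hinf
      simp [List.tfae_cons_cons, hs, hs0, hinf]
  · intro G _ hG
    have hle := StringNumber.nullStringNumber_le_stringNumber G
    tfae_have 1 → 2 := fun h => le_zero_iff.1 (h ▸ hle)
    tfae_have 2 → 3 := fun h p hp => by
      by_contra hinf
      -- `AddCommGroup.primaryComponent G p` and `powTorsion G p` are identified by unfolding.
      have : Infinite (StringNumber.powTorsion G p) := not_finite_iff_infinite.1 hinf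
      obtain ⟨φ, x, hx⟩ := StringNumber.exists_isNullString_of_infinite_powTorsion hG hp
      simp [hx.nullStringNumber_eq_top] at h
    tfae_have 3 → 1 := fun h => StringNumber.stringNumber_eq_zero
      (StringNumber.not_isString_of_isAddTorsion hG h)
    tfae_finish
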